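/- Let $(B,g_B)$ and $(F,g_F)$ be (finite-dimensional, smooth) semi-Riemannian manifolds, let $f:B\to\mathbb R$ be a smooth positive non-constant function, and let $M=B\times_f F$ be the warped product, i.e. the manifold $B\times F$ with the metric $\tilde g=\pi^*g_B+(f\circ\pi)^2\,\sigma^*g_F$, where $\pi:B\times F\to B$ and $\sigma:B\times F\to F$ are the projections. Suppose that $(M,\tilde g)$ is a gradient Ricci soliton whose potential function depends only on the base: there are a function $h:B\to\mathbb R$ with $h\circ\pi$ smooth and a constant $\rho\in\mathbb R$ such that $$\operatorname{Ric}_{\tilde g}+\operatorname{Hess}_{\tilde g}(h\circ\pi)=\rho\,\tilde g .$$ Then the fiber $F$ is an Einstein manifold: there is a constant $\lambda_F\in\mathbb R$ with $\operatorname{Ric}_{g_F}=\lambda_F\,g_F$ on $F$. -/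

import Mathlib

open scoped Manifold ContDiff Topology

noncomputable section

namespace SemiRiem

/-! ### Local formulas

`G` is a field of symmetric bilinear forms on (an open part of) a finite-dimensional real vector
space `E`, i.e. a metric tensor in coordinates. Vectors of `E` are identified with constant vector
fields, so that all brackets vanish. -/

section Local

variable {E : Type*} [NormedAddCommGroup E] [NormedSpace ℝ E]

/-- The lowered Christoffel symbols (Koszul formula for constant vector fields):
`koszul G y u v w = ½ (∂_u G(v, w) + ∂_v G(u, w) - ∂_w G(u, v))` at the point `y`. -/
def koszul (G : E → E →L[ℝ] E →L[ℝ] ℝ) (y u v : E) : E →L[ℝ] ℝ :=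
  (1 / 2 : ℝ) • (fderiv ℝ G y u v + fderiv ℝ G y v u - ((fderiv ℝ G y).flip u).flip v)

theorem koszul_apply (G : E → E →L[ℝ] E →L[ℝ] ℝ) (y u v w : E) :
    koszul G y u v w =
      1 / 2 * (fderiv ℝ G y u v w + fderiv ℝ G y v u w - fderiv ℝ G y w u v) := by
  simp [koszul]

/-- The Christoffel symbols `Γ_y(u, v) = ∇_u v` (`v` a constant field) of the Levi-Civita
connection of `G`: if `G y` is nondegenerate, `Γ_y(u, v)` is the unique vector with
`G y (Γ_y(u, v)) w = koszul G y u v w` for all `w`. -/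
def christoffel (G : E → E →L[ℝ] E →L[ℝ] ℝ) (y : E) (u v : E) : E :=
  (G y).inverse (koszul G y u v)

/-- The Riemann curvature tensor `R(u, v) w = ∇_u ∇_v w - ∇_v ∇_u w` (constant vector fields) at
the point `y`. -/
def curvature (G : E → E →L[ℝ] E →L[ℝ] ℝ) (y : E) (u v w : E) : E :=
  fderiv ℝ (fun z ↦ christoffel G z v w) y u - fderiv ℝ (fun z ↦ christoffel G z u w) y v
    + christoffel G y u (christoffel G y v w) - christoffel G y v (christoffel G y u w)

/-- The Ricci tensor `Ric(v, w) = tr (u ↦ R(u, v) w)` at the point `y`; the trace is written in a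
basis of `E`. -/
def localRicci [FiniteDimensional ℝ E] (G : E → E →L[ℝ] E →L[ℝ] ℝ) (y : E) (v w : E) : ℝ :=
  ∑ i, (Module.finBasis ℝ E).repr (curvature G y (Module.finBasis ℝ E i) v w) i

/-- The Hessian `Hess h (u, v) = u (v h) - (∇_u v) h` (constant vector fields) at the point `y`. -/
def localHessian (G : E → E →L[ℝ] E →L[ℝ] ℝ) (h : E → ℝ) (y : E) (u v : E) : ℝ :=
  fderiv ℝ (fun z ↦ fderiv ℝ h z v) y u - fderiv ℝ h y (christoffel G y u v)

end Local

/-! ### Semi-Riemannian metrics on manifolds -/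

/-- The pullback `(u, v) ↦ b (A u) (A v)` of a bilinear form along a linear map. -/
def pullbackForm {V W : Type*} [AddCommGroup V] [Module ℝ V] [TopologicalSpace V]
    [IsTopologicalAddGroup V] [ContinuousSMul ℝ V] [AddCommGroup W] [Module ℝ W]
    [TopologicalSpace W] [IsTopologicalAddGroup W] [ContinuousSMul ℝ W]
    (b : W →L[ℝ] W →L[ℝ] ℝ) (A : V →L[ℝ] W) : V →L[ℝ] V →L[ℝ] ℝ :=
  (ContinuousLinearMap.precomp ℝ A).comp (b.comp A)

@[simp]
theorem pullbackForm_apply {V W : Type*} [AddCommGroup V] [Module ℝ V] [TopologicalSpace V]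
    [IsTopologicalAddGroup V] [ContinuousSMul ℝ V] [AddCommGroup W] [Module ℝ W]
    [TopologicalSpace W] [IsTopologicalAddGroup W] [ContinuousSMul ℝ W]
    (b : W →L[ℝ] W →L[ℝ] ℝ) (A : V →L[ℝ] W) (u v : V) :
    pullbackForm b A u v = b (A u) (A v) := rfl

theorem contDiffAt_smul {X W : Type*} [NormedAddCommGroup X] [NormedSpace ℝ X]
    [NormedAddCommGroup W] [NormedSpace ℝ W] {a : X → ℝ} {b : X → W} {x : X}
    (ha : ContDiffAt ℝ ∞ a x) (hb : ContDiffAt ℝ ∞ b x) :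
    ContDiffAt ℝ ∞ (fun y ↦ a y • b y) x := ha.smul hb

theorem contDiff_pullbackForm {V W : Type*} [NormedAddCommGroup V] [NormedSpace ℝ V]
    [NormedAddCommGroup W] [NormedSpace ℝ W] (A : V →L[ℝ] W) :
    ContDiff ℝ ∞ (fun b : W →L[ℝ] W →L[ℝ] ℝ ↦ pullbackForm b A) :=
  contDiff_const.clm_comp (contDiff_id.clm_comp contDiff_const)

section Global

variable {E : Type*} [NormedAddCommGroup E] [NormedSpace ℝ E]
  {H : Type*} [TopologicalSpace H] (I : ModelWithCorners ℝ E H)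
  (M : Type*) [TopologicalSpace M] [ChartedSpace H M]

/-- A (smooth) semi-Riemannian metric: a smooth field of nondegenerate symmetric bilinear forms on
the tangent spaces. Its index is automatically constant on each connected component. -/
structure Metric [IsManifold I ∞ M] where
  /-- The bilinear form on each tangent space. -/
  form (x : M) : TangentSpace I x →L[ℝ] TangentSpace I x →L[ℝ] ℝ
  symm (x : M) (u v : TangentSpace I x) : form x u v = form x v u
  nondegenerate (x : M) (u : TangentSpace I x) (hu : ∀ v, form x u v = 0) : u = 0
  contMDiff : ContMDiff I (I.prod 𝓘(ℝ, E →L[ℝ] E →L[ℝ] ℝ)) ∞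
    (fun x ↦ Bundle.TotalSpace.mk' (E →L[ℝ] E →L[ℝ] ℝ)
      (E := fun x : M ↦ TangentSpace I x →L[ℝ] TangentSpace I x →L[ℝ] ℝ) x (form x))

variable {M}

/-- The coordinate expression, in the chart at `c`, of a field of bilinear forms on the tangent
spaces: the pullback by the inverse of that chart. -/
def inChart (g : ∀ x : M, TangentSpace I x →L[ℝ] TangentSpace I x →L[ℝ] ℝ) (c : M) (y : E) :
    E →L[ℝ] E →L[ℝ] ℝ :=
  pullbackForm (g ((extChartAt I c).symm y)) (mfderiv 𝓘(ℝ, E) I (extChartAt I c).symm y)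

/-- Smoothness of a field of bilinear forms, read in the chart. -/
theorem contMDiffAt_iff_inChart [IsManifold I ∞ M] [I.Boundaryless]
    (g : ∀ x : M, TangentSpace I x →L[ℝ] TangentSpace I x →L[ℝ] ℝ) (c : M) :
    ContMDiffAt I (I.prod 𝓘(ℝ, E →L[ℝ] E →L[ℝ] ℝ)) ∞
      (fun x ↦ Bundle.TotalSpace.mk' (E →L[ℝ] E →L[ℝ] ℝ)
        (E := fun x : M ↦ TangentSpace I x →L[ℝ] TangentSpace I x →L[ℝ] ℝ) x (g x)) c ↔
    ContDiffAt ℝ ∞ (inChart I g c) (extChartAt I c c) := by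
  have key : ∀ x ∈ (chartAt H c).source,
      (trivializationAt (E →L[ℝ] E →L[ℝ] ℝ)
        (fun x : M ↦ TangentSpace I x →L[ℝ] TangentSpace I x →L[ℝ] ℝ) c ⟨x, g x⟩).2 =
      inChart I g c (extChartAt I c x) := by
    intro x hx
    rw [hom_trivializationAt_apply]
    ext u v
    simp only
    have hx' : x ∈ (trivializationAt E (TangentSpace I) c).baseSet := by simpa using hx
    rw [inCoordinates_apply_eq₂ hx' hx' (by simp)]
    have e := TangentBundle.symmL_trivializationAt (I := I) hx
    rw [ModelWithCorners.range_eq_univ, mfderivWithin_univ] at e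
    have hl := (extChartAt I c).left_inv (by simpa using hx : x ∈ (extChartAt I c).source)
    have hz : ∀ z, z = x → ∀ a b : E, (g z : E →L[ℝ] E →L[ℝ] ℝ) a b =
        (g x : E →L[ℝ] E →L[ℝ] ℝ) a b := by rintro _ rfl _ _; rfl
    have eu : (trivializationAt E (TangentSpace I) c).symm x u =
      mfderiv 𝓘(ℝ, E) I (extChartAt I c).symm (extChartAt I c x) u :=
      ((trivializationAt E (TangentSpace I) c).symmL_apply (R := ℝ) hx' u).symm.trans (DFunLike.congr_fun e u)
    have ev : (trivializationAt E (TangentSpace I) c).symm x v =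
      mfderiv 𝓘(ℝ, E) I (extChartAt I c).symm (extChartAt I c x) v :=
      ((trivializationAt E (TangentSpace I) c).symmL_apply (R := ℝ) hx' v).symm.trans (DFunLike.congr_fun e v)
    have et : (trivializationAt ℝ (fun _ : M ↦ ℝ) c).linearMapAt ℝ x = LinearMap.id :=
      Bundle.Trivial.linearMapAt_trivialization ℝ M ℝ x
    rw [eu, ev, et]
    exact (hz _ hl _ _).symm
  rw [Bundle.contMDiffAt_section]
  have hkey := Filter.eventually_of_mem (chart_source_mem_nhds H c) key
  rw [Filter.EventuallyEq.contMDiffAt_iff hkey]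
  constructor
  · intro h
    have h' := (contMDiffAt_iff.1 h).2
    rw [ModelWithCorners.range_eq_univ, contDiffWithinAt_univ] at h'
    refine h'.congr_of_eventuallyEq ?_
    filter_upwards [extChartAt_target_mem_nhds (I := I) c] with y hy
    have hr := (extChartAt I c).right_inv hy
    change _ = inChart I g c (extChartAt I c ((extChartAt I c).symm y))
    rw [hr]
  · intro h
    exact ContMDiffAt.comp (I' := 𝓘(ℝ, E)) c h.contMDiffAt contMDiffAt_extChartAt

variable {I}

/-- The Ricci tensor of `g` at `x`, computed in the chart at `x`. (The local
expression is tensorial, so that every other chart around `x` gives the same value.) -/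
def Metric.ricci [FiniteDimensional ℝ E] [IsManifold I ∞ M] (g : Metric I M) (x : M)
    (u v : TangentSpace I x) : ℝ :=
  localRicci (inChart I g.form x) (extChartAt I x x)
    (mfderiv I 𝓘(ℝ, E) (extChartAt I x) x u) (mfderiv I 𝓘(ℝ, E) (extChartAt I x) x v)

/-- The Hessian of `h` with respect to `g` at `x`, computed in the chart at `x`. (The local
expression is tensorial, so that every other chart around `x` gives the same value.) -/
def Metric.hessian [IsManifold I ∞ M] (g : Metric I M) (h : M → ℝ) (x : M)
    (u v : TangentSpace I x) : ℝ :=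
  localHessian (inChart I g.form x) (h ∘ (extChartAt I x).symm) (extChartAt I x x)
    (mfderiv I 𝓘(ℝ, E) (extChartAt I x) x u) (mfderiv I 𝓘(ℝ, E) (extChartAt I x) x v)

/-- `(M, g)` is an Einstein manifold: `Ric_g = c g` for a constant `c`. -/
def Metric.IsEinstein [FiniteDimensional ℝ E] [IsManifold I ∞ M] (g : Metric I M) : Prop :=
  ∃ c : ℝ, ∀ (x : M) (u v : TangentSpace I x), g.ricci x u v = c * g.form x u v

/-- `(M, g)` is a gradient Ricci soliton with (smooth) potential function `h`:
`Ric_g + Hess_g h = ρ g` for a constant `ρ`. -/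
def Metric.IsGradientRicciSoliton [FiniteDimensional ℝ E] [IsManifold I ∞ M] (g : Metric I M)
    (h : M → ℝ) : Prop :=
  ContMDiff I 𝓘(ℝ, ℝ) ∞ h ∧
    ∃ ρ : ℝ, ∀ (x : M) (u v : TangentSpace I x),
      g.ricci x u v + g.hessian h x u v = ρ * g.form x u v

end Global

section Warped

variable {EB : Type*} [NormedAddCommGroup EB] [NormedSpace ℝ EB]
  {HB : Type*} [TopologicalSpace HB] {IB : ModelWithCorners ℝ EB HB}
  {B : Type*} [TopologicalSpace B] [ChartedSpace HB B]
  {EF : Type*} [NormedAddCommGroup EF] [NormedSpace ℝ EF]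
  {HF : Type*} [TopologicalSpace HF] {IF : ModelWithCorners ℝ EF HF}
  {F : Type*} [TopologicalSpace F] [ChartedSpace HF F]

/-- The tensor field `π^* b + (f ∘ π)² σ^* k` on `B × F`, for fields of bilinear forms `b` on `B`
and `k` on `F`, where `π`, `σ` are the projections of `B × F`. -/
def warpedForm (b : ∀ x : B, TangentSpace IB x →L[ℝ] TangentSpace IB x →L[ℝ] ℝ) (f : B → ℝ)
    (k : ∀ x : F, TangentSpace IF x →L[ℝ] TangentSpace IF x →L[ℝ] ℝ) (p : B × F) :
    TangentSpace (IB.prod IF) p →L[ℝ] TangentSpace (IB.prod IF) p →L[ℝ] ℝ :=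
  pullbackForm (b p.1) (mfderiv (IB.prod IF) IB Prod.fst p) +
    f p.1 ^ 2 • pullbackForm (k p.2) (mfderiv (IB.prod IF) IF Prod.snd p)

theorem warpedForm_apply (b : ∀ x : B, TangentSpace IB x →L[ℝ] TangentSpace IB x →L[ℝ] ℝ)
    (f : B → ℝ) (k : ∀ x : F, TangentSpace IF x →L[ℝ] TangentSpace IF x →L[ℝ] ℝ) (p : B × F)
    (u v : EB × EF) :
    warpedForm b f k p u v = b p.1 u.1 v.1 + f p.1 ^ 2 * k p.2 u.2 v.2 := by
  unfold warpedForm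
  rw [mfderiv_fst, mfderiv_snd]
  rfl

/-- The coordinate expression of the tensor field of a warped product. -/
theorem inChart_warpedForm [IB.Boundaryless] [IF.Boundaryless]
    [IsManifold IB ∞ B] [IsManifold IF ∞ F]
    (b : ∀ x : B, TangentSpace IB x →L[ℝ] TangentSpace IB x →L[ℝ] ℝ)
    (f : B → ℝ) (k : ∀ x : F, TangentSpace IF x →L[ℝ] TangentSpace IF x →L[ℝ] ℝ) (p : B × F)
    {y : EB × EF} (hy : y ∈ (extChartAt (IB.prod IF) p).target) :
    inChart (IB.prod IF) (warpedForm b f k) p y =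
      pullbackForm (inChart IB b p.1 y.1) (ContinuousLinearMap.fst ℝ EB EF) +
        f ((extChartAt IB p.1).symm y.1) ^ 2 •
          pullbackForm (inChart IF k p.2 y.2) (ContinuousLinearMap.snd ℝ EB EF) := by
  have hy' : y.1 ∈ (extChartAt IB p.1).target ∧ y.2 ∈ (extChartAt IF p.2).target := by
    rw [extChartAt_prod] at hy
    exact hy
  have e1 : ∀ z, ((extChartAt (IB.prod IF) p).symm z).1 = (extChartAt IB p.1).symm z.1 := by
    intro z; rw [extChartAt_prod]; rfl
  have e2 : ∀ z, ((extChartAt (IB.prod IF) p).symm z).2 = (extChartAt IF p.2).symm z.2 := by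
    intro z; rw [extChartAt_prod]; rfl
  have hd : MDifferentiableAt 𝓘(ℝ, EB × EF) (IB.prod IF) (extChartAt (IB.prod IF) p).symm y := by
    have := mdifferentiableWithinAt_extChartAt_symm (I := IB.prod IF) hy
    rwa [ModelWithCorners.range_eq_univ, mdifferentiableWithinAt_univ] at this
  have hdB : MDifferentiableAt 𝓘(ℝ, EB) IB (extChartAt IB p.1).symm y.1 := by
    have := mdifferentiableWithinAt_extChartAt_symm (I := IB) hy'.1
    rwa [ModelWithCorners.range_eq_univ, mdifferentiableWithinAt_univ] at this
  have hdF : MDifferentiableAt 𝓘(ℝ, EF) IF (extChartAt IF p.2).symm y.2 := by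
    have := mdifferentiableWithinAt_extChartAt_symm (I := IF) hy'.2
    rwa [ModelWithCorners.range_eq_univ, mdifferentiableWithinAt_univ] at this
  have h1 : (mfderiv (IB.prod IF) IB Prod.fst ((extChartAt (IB.prod IF) p).symm y)).comp
      (mfderiv 𝓘(ℝ, EB × EF) (IB.prod IF) (extChartAt (IB.prod IF) p).symm y) =
      (mfderiv 𝓘(ℝ, EB) IB (extChartAt IB p.1).symm y.1).comp
        (ContinuousLinearMap.fst ℝ EB EF) := by
    have a1 := mfderiv_comp y (mdifferentiableAt_fst (I := IB) (I' := IF)) hd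
    have a2 := mfderiv_comp (I := 𝓘(ℝ, EB × EF)) (f := (Prod.fst : EB × EF → EB)) y hdB
      differentiableAt_fst.mdifferentiableAt
    rw [mfderiv_eq_fderiv, fderiv_fst] at a2
    have a3 : (Prod.fst ∘ (extChartAt (IB.prod IF) p).symm : EB × EF → B) =
      (extChartAt IB p.1).symm ∘ Prod.fst := funext e1
    rw [← a1, a3]
    exact a2
  have h2 : (mfderiv (IB.prod IF) IF Prod.snd ((extChartAt (IB.prod IF) p).symm y)).comp
      (mfderiv 𝓘(ℝ, EB × EF) (IB.prod IF) (extChartAt (IB.prod IF) p).symm y) =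
      (mfderiv 𝓘(ℝ, EF) IF (extChartAt IF p.2).symm y.2).comp
        (ContinuousLinearMap.snd ℝ EB EF) := by
    have a1 := mfderiv_comp y (mdifferentiableAt_snd (I := IB) (I' := IF)) hd
    have a2 := mfderiv_comp (I := 𝓘(ℝ, EB × EF)) (f := (Prod.snd : EB × EF → EF)) y hdF
      differentiableAt_snd.mdifferentiableAt
    rw [mfderiv_eq_fderiv, fderiv_snd] at a2
    have a3 : (Prod.snd ∘ (extChartAt (IB.prod IF) p).symm : EB × EF → F) =
      (extChartAt IF p.2).symm ∘ Prod.snd := funext e2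
    rw [← a1, a3]
    exact a2
  refine ContinuousLinearMap.ext fun u ↦ ContinuousLinearMap.ext fun v ↦ ?_
  have h1' := fun w ↦ DFunLike.congr_fun h1 w
  have h2' := fun w ↦ DFunLike.congr_fun h2 w
  simp only [ContinuousLinearMap.comp_apply] at h1' h2'
  simp only [inChart, warpedForm, pullbackForm_apply, add_apply, smul_apply, smul_eq_mul]
  have hg : ∀ q r : B × F, q = r → ∀ a₁ a₂ : EB, ∀ c₁ c₂ : EF,
      (b q.1 : EB →L[ℝ] EB →L[ℝ] ℝ) a₁ a₂ +
        f q.1 ^ 2 * (k q.2 : EF →L[ℝ] EF →L[ℝ] ℝ) c₁ c₂ =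
      (b r.1 : EB →L[ℝ] EB →L[ℝ] ℝ) a₁ a₂ +
        f r.1 ^ 2 * (k r.2 : EF →L[ℝ] EF →L[ℝ] ℝ) c₁ c₂ := by
    rintro q _ rfl _ _ _ _; rfl
  refine Eq.trans ?_ (hg _ ((extChartAt IB p.1).symm y.1, (extChartAt IF p.2).symm y.2)
    (Prod.ext (e1 y) (e2 y)) _ _ _ _)
  exact congrArg₂ (· + ·)
    (congrArg₂ (fun a c ↦ (b ((extChartAt (IB.prod IF) p).symm y).1 : EB →L[ℝ] EB →L[ℝ] ℝ) a c)
      (h1' u) (h1' v))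
    (congrArg (f ((extChartAt (IB.prod IF) p).symm y).1 ^ 2 * ·)
      (congrArg₂ (fun a c ↦ (k ((extChartAt (IB.prod IF) p).symm y).2 : EF →L[ℝ] EF →L[ℝ] ℝ) a c)
        (h2' u) (h2' v)))

/-- The warped product `B ×_f F`: the manifold `B × F` with the metric
`π^* g_B + (f ∘ π)² σ^* g_F`. -/
def warpedProduct [IB.Boundaryless] [IF.Boundaryless]
    [IsManifold IB ∞ B] [IsManifold IF ∞ F] (gB : Metric IB B) (gF : Metric IF F) (f : B → ℝ)
    (hf : ContMDiff IB 𝓘(ℝ, ℝ) ∞ f) (hpos : ∀ x, 0 < f x) : Metric (IB.prod IF) (B × F) where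
  form := warpedForm gB.form f gF.form
  symm p u v := by
    refine (warpedForm_apply gB.form f gF.form p u v).trans
      (Eq.trans ?_ (warpedForm_apply gB.form f gF.form p v u).symm)
    exact congrArg₂ (· + ·) (gB.symm p.1 u.1 v.1)
      (congrArg (f p.1 ^ 2 * ·) (gF.symm p.2 u.2 v.2))
  nondegenerate p u hu := by
    have h1 : u.1 = 0 := gB.nondegenerate p.1 u.1 fun v ↦ by
      have h := (warpedForm_apply gB.form f gF.form p u (v, (0 : EF))).symm.trans (hu (v, (0 : EF)))
      have h0 : gF.form p.2 u.2 (0 : TangentSpace IF p.2) = 0 := map_zero _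
      replace h : gB.form p.1 u.1 v + f p.1 ^ 2 * gF.form p.2 u.2 (0 : TangentSpace IF p.2) = 0 := h
      rwa [h0, mul_zero, add_zero] at h
    have h2 : u.2 = 0 := gF.nondegenerate p.2 u.2 fun v ↦ by
      have h := (warpedForm_apply gB.form f gF.form p u ((0 : EB), v)).symm.trans (hu ((0 : EB), v))
      have h0 : gB.form p.1 u.1 (0 : TangentSpace IB p.1) = 0 := map_zero _
      replace h : gB.form p.1 u.1 (0 : TangentSpace IB p.1) + f p.1 ^ 2 * gF.form p.2 u.2 v = 0 := h
      rw [h0, zero_add] at h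
      exact (mul_eq_zero.1 h).resolve_left (pow_ne_zero 2 (hpos p.1).ne')
    exact Prod.ext h1 h2
  contMDiff p := by
    rw [contMDiffAt_iff_inChart]
    have hB := (contMDiffAt_iff_inChart IB gB.form p.1).1 (gB.contMDiff p.1)
    have hF := (contMDiffAt_iff_inChart IF gF.form p.2).1 (gF.contMDiff p.2)
    have hφ : extChartAt (IB.prod IF) p p = (extChartAt IB p.1 p.1, extChartAt IF p.2 p.2) := by
      rw [extChartAt_prod]; rfl
    have hff : ContDiffAt ℝ ∞ (fun a ↦ f ((extChartAt IB p.1).symm a)) (extChartAt IB p.1 p.1) := by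
      have := (contMDiffAt_iff.1 (hf p.1)).2
      rwa [ModelWithCorners.range_eq_univ, contDiffWithinAt_univ] at this
    have heq := Filter.eventually_of_mem (extChartAt_target_mem_nhds (I := IB.prod IF) p)
      (fun y hy ↦ inChart_warpedForm gB.form f gF.form p hy)
    refine ContDiffAt.congr_of_eventuallyEq ?_ heq
    rw [hφ]
    have t1 : ContDiffAt ℝ ∞ (fun x : EB × EF ↦
        pullbackForm (inChart IB gB.form p.1 x.1) (ContinuousLinearMap.fst ℝ EB EF))
        (extChartAt IB p.1 p.1, extChartAt IF p.2 p.2) :=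
      (contDiff_pullbackForm _).contDiffAt.comp _ (ContDiffAt.comp (g := inChart IB gB.form p.1)
        (extChartAt IB p.1 p.1, extChartAt IF p.2 p.2) hB contDiffAt_fst)
    have t2 : ContDiffAt ℝ ∞ (fun x : EB × EF ↦
        pullbackForm (inChart IF gF.form p.2 x.2) (ContinuousLinearMap.snd ℝ EB EF))
        (extChartAt IB p.1 p.1, extChartAt IF p.2 p.2) :=
      (contDiff_pullbackForm _).contDiffAt.comp _ (ContDiffAt.comp (g := inChart IF gF.form p.2)
        (extChartAt IB p.1 p.1, extChartAt IF p.2 p.2) hF contDiffAt_snd)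
    have t3 : ContDiffAt ℝ ∞ (fun x : EB × EF ↦ f ((extChartAt IB p.1).symm x.1) ^ 2)
        (extChartAt IB p.1 p.1, extChartAt IF p.2 p.2) :=
      (ContDiffAt.comp (g := fun a ↦ f ((extChartAt IB p.1).symm a))
        (extChartAt IB p.1 p.1, extChartAt IF p.2 p.2) hff contDiffAt_fst).pow 2
    have t4 : ContDiffAt ℝ ∞ (fun x : EB × EF ↦ f ((extChartAt IB p.1).symm x.1) ^ 2 •
        pullbackForm (inChart IF gF.form p.2 x.2) (ContinuousLinearMap.snd ℝ EB EF))
        (extChartAt IB p.1 p.1, extChartAt IF p.2 p.2) :=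
      contDiffAt_smul t3 t2
    exact t1.add t4

end Warped

end SemiRiem

end

/-!
Near a point of `B × F`, the warped product metric reads `b + φ² k` in product coordinates, where
`b`, `k` are the coordinate expressions of the metrics of base and fiber and `φ` is that of `f`. Its
Christoffel symbols (`christoffel_warpedCoord`) are

`Γ(u, v) = (Γ_b(u₁, v₁) - φ k(u₂, v₂) ∇φ, Γ_k(u₂, v₂) + (dφ(u₁)/φ) v₂ + (dφ(v₁)/φ) u₂)`.

For vertical `v`, `w` (tangent to the fiber), taking the traces of the two diagonal blocks of
`u ↦ R(u, v) w` gives `Ric(v, w) = Ric_k(v, w) + c k(v, w)`, where `c` depends on the point of the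
base only (`localRicci_warpedCoord`). The Hessian of the lift of a function `h` on the base is a
multiple of `k` too on vertical vectors, by `φ dh(∇φ)`, again a number determined by the point of
the base (`localHessian_warpedCoord`). Hence, on vertical vectors over a fixed point `p` of the
base, the soliton equation reads `Ric_F + c(p) g_F + c'(p) g_F = ρ f(p)² g_F` at every point of the
fiber, and `F` is Einstein with constant `ρ f(p)² - c(p) - c'(p)`.
-/

namespace SemiRiem

/-! ### The Levi-Civita connection of a metric in coordinates -/

section Coordinates

variable {E : Type*} [NormedAddCommGroup E] [NormedSpace ℝ E]
  {G G' : E → E →L[ℝ] E →L[ℝ] ℝ} {y : E}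

theorem isInvertible_of_nondegenerate [FiniteDimensional ℝ E] (A : E →L[ℝ] E →L[ℝ] ℝ)
    (hA : ∀ u, (∀ v, A u v = 0) → u = 0) : A.IsInvertible := by
  have hinj : Function.Injective (A : E →ₗ[ℝ] E →L[ℝ] ℝ) :=
    (injective_iff_map_eq_zero _).2 fun u hu ↦ hA u fun v ↦ DFunLike.congr_fun hu v
  have hdim : Module.finrank ℝ E = Module.finrank ℝ (E →L[ℝ] ℝ) := by
    rw [← (LinearMap.toContinuousLinearMap (𝕜 := ℝ) (E := E) (F' := ℝ)).finrank_eq]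
    exact Subspace.dual_finrank_eq.symm
  exact ⟨(LinearMap.linearEquivOfInjective _ hinj hdim).toContinuousLinearEquiv,
    ContinuousLinearMap.ext fun _ ↦ rfl⟩

theorem eventually_isInvertible [FiniteDimensional ℝ E] (hG : ContinuousAt G y)
    (hy : (G y).IsInvertible) : ∀ᶠ z in 𝓝 y, (G z).IsInvertible := by
  have := FiniteDimensional.complete ℝ E
  obtain ⟨e, he⟩ := hy
  exact hG (he ▸ ContinuousLinearEquiv.nhds e)

/-- The Koszul formula characterizes the Christoffel symbols. -/
theorem christoffel_eq_of_koszul (hy : (G y).IsInvertible) {u v x : E}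
    (hx : ∀ w, G y x w = koszul G y u v w) : christoffel G y u v = x := by
  rw [christoffel, ← show G y x = koszul G y u v from ContinuousLinearMap.ext hx,
    hy.inverse_apply_self]

theorem form_christoffel (hy : (G y).IsInvertible) (u v w : E) :
    G y (christoffel G y u v) w = koszul G y u v w := by
  rw [christoffel, hy.self_apply_inverse]

theorem christoffel_add_left (u u' v : E) :
    christoffel G y (u + u') v = christoffel G y u v + christoffel G y u' v := by
  simp only [christoffel, ← map_add]
  congr 1
  ext w
  simp only [koszul_apply, map_add, add_apply]
  ring

theorem christoffel_smul_left (c : ℝ) (u v : E) :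
    christoffel G y (c • u) v = c • christoffel G y u v := by
  simp only [christoffel, ← map_smul]
  congr 1
  ext w
  simp only [koszul_apply, map_smul, smul_apply, smul_eq_mul]
  ring

theorem christoffel_add_right (u v v' : E) :
    christoffel G y u (v + v') = christoffel G y u v + christoffel G y u v' := by
  simp only [christoffel, ← map_add]
  congr 1
  ext w
  simp only [koszul_apply, map_add, add_apply]
  ring

theorem christoffel_smul_right (c : ℝ) (u v : E) :
    christoffel G y u (c • v) = c • christoffel G y u v := by
  simp only [christoffel, ← map_smul]
  congr 1
  ext w
  simp only [koszul_apply, map_smul, smul_apply, smul_eq_mul]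
  ring

@[simp]
theorem christoffel_zero_left (v : E) : christoffel G y 0 v = 0 := by
  simpa using christoffel_smul_left (G := G) (y := y) 0 0 v

@[simp]
theorem christoffel_zero_right (u : E) : christoffel G y u 0 = 0 := by
  simpa using christoffel_smul_right (G := G) (y := y) 0 u 0

-- The type of `fderiv ℝ G` gets its additive group structure only at a higher pending depth.
set_option maxSynthPendingDepth 5 in
theorem differentiableAt_christoffel [FiniteDimensional ℝ E] (hG : ContDiffAt ℝ ∞ G y)
    (hy : (G y).IsInvertible) (u v : E) :
    DifferentiableAt ℝ (fun z ↦ christoffel G z u v) y := by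
  have := FiniteDimensional.complete ℝ E
  have hinv : DifferentiableAt ℝ (fun z ↦ (G z).inverse) y :=
    ((hy.contDiffAt_map_inverse (n := ∞)).comp y hG).differentiableAt (by simp)
  have hd (a : E) : DifferentiableAt ℝ (fun z ↦ fderiv ℝ G z a) y :=
    ((hG.fderiv_right (m := ∞) (by simp)).clm_apply
      (contDiffAt_const (c := a))).differentiableAt (by simp)
  have hflip : DifferentiableAt ℝ (fun z ↦ ((fderiv ℝ G z).flip u).flip v) y := by
    let e₁ := (ContinuousLinearMap.flipₗᵢ ℝ E E (E →L[ℝ] ℝ)).toContinuousLinearEquiv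
    let e₂ := (ContinuousLinearMap.flipₗᵢ ℝ E E ℝ).toContinuousLinearEquiv
    have h₁ : ContDiffAt ℝ ∞ (fun z ↦ (fderiv ℝ G z).flip) y :=
      e₁.contDiff.contDiffAt.comp y (hG.fderiv_right (m := ∞) (by simp))
    have h₂ : ContDiffAt ℝ ∞ (fun z ↦ ((fderiv ℝ G z).flip u).flip) y :=
      e₂.contDiff.contDiffAt.comp y (h₁.clm_apply contDiffAt_const)
    exact (h₂.clm_apply contDiffAt_const).differentiableAt (by simp)
  have hk : DifferentiableAt ℝ (fun z ↦ koszul G z u v) y := by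
    unfold koszul
    exact ((((hd u).clm_apply (differentiableAt_const v)).fun_add
      ((hd v).clm_apply (differentiableAt_const u))).fun_sub hflip).fun_const_smul _
  exact hinv.clm_apply hk

/-- The Ricci tensor is the trace of any linear map `u ↦ R(u, v) w`. -/
theorem localRicci_eq_trace [FiniteDimensional ℝ E] {v w : E} (L : E →ₗ[ℝ] E)
    (hL : ∀ u, L u = curvature G y u v w) : localRicci G y v w = LinearMap.trace ℝ E L := by
  rw [LinearMap.trace_eq_matrix_trace ℝ (Module.finBasis ℝ E), Matrix.trace]
  simp only [localRicci, Matrix.diag_apply, LinearMap.toMatrix_apply, hL]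

/-- `u ↦ R(u, v) w` is linear where the Christoffel symbols are differentiable. -/
theorem exists_linearMap_curvature [FiniteDimensional ℝ E] (hG : ContDiffAt ℝ ∞ G y)
    (hy : (G y).IsInvertible) (v w : E) : ∃ L : E →ₗ[ℝ] E, ∀ u, L u = curvature G y u v w := by
  have hd := differentiableAt_christoffel hG hy
  refine ⟨⟨⟨fun u ↦ curvature G y u v w, fun u u' ↦ ?_⟩, fun c u ↦ ?_⟩, fun u ↦ rfl⟩
  · simp only [curvature, christoffel_add_left, christoffel_add_right, map_add]
    rw [fderiv_fun_add (hd u w) (hd u' w), add_apply]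
    abel
  · simp only [curvature, christoffel_smul_left, christoffel_smul_right, map_smul,
      RingHom.id_apply]
    rw [fderiv_fun_const_smul (hd u w), smul_apply]
    module

theorem christoffel_congr (h : G =ᶠ[𝓝 y] G') : christoffel G y = christoffel G' y := by
  funext u v
  rw [christoffel, christoffel, koszul, koszul, h.fderiv_eq, h.eq_of_nhds]

theorem localRicci_congr [FiniteDimensional ℝ E] (h : G =ᶠ[𝓝 y] G') :
    localRicci G y = localRicci G' y := by
  have hΓ (u v : E) :
      (fun z ↦ christoffel G z u v) =ᶠ[𝓝 y] fun z ↦ christoffel G' z u v :=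
    (eventually_eventually_nhds.2 h).mono fun z hz ↦
      congrFun₂ (christoffel_congr (show G =ᶠ[𝓝 z] G' from hz)) u v
  funext v w
  simp only [localRicci, curvature, (hΓ _ _).fderiv_eq, christoffel_congr h]

theorem localHessian_congr (h : G =ᶠ[𝓝 y] G') (η : E → ℝ) :
    localHessian G η y = localHessian G' η y := by
  funext u v
  rw [localHessian, localHessian, christoffel_congr h]

/-- The gradient of a function with respect to a metric in coordinates. -/
noncomputable def gradient (G : E → E →L[ℝ] E →L[ℝ] ℝ) (φ : E → ℝ) (y : E) : E :=
  (G y).inverse (fderiv ℝ φ y)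

theorem form_gradient (hy : (G y).IsInvertible) (φ : E → ℝ) (w : E) :
    G y (gradient G φ y) w = fderiv ℝ φ y w := by
  rw [gradient, hy.self_apply_inverse]

theorem differentiableAt_gradient [FiniteDimensional ℝ E] (hG : ContDiffAt ℝ ∞ G y)
    (hy : (G y).IsInvertible) {φ : E → ℝ} (hφ : ContDiffAt ℝ ∞ φ y) :
    DifferentiableAt ℝ (gradient G φ) y := by
  have := FiniteDimensional.complete ℝ E
  exact (((hy.contDiffAt_map_inverse (n := ∞)).comp y hG).differentiableAt (by simp)).clm_apply
    ((hφ.fderiv_right (m := ∞) (by simp)).differentiableAt (by simp))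

end Coordinates

/-! ### Partial derivatives and traces on a product -/

section Product

variable {E₁ E₂ W : Type*} [NormedAddCommGroup E₁] [NormedSpace ℝ E₁] [NormedAddCommGroup E₂]
  [NormedSpace ℝ E₂] [NormedAddCommGroup W] [NormedSpace ℝ W]

theorem fderiv_apply_inl {Φ : E₁ × E₂ → W} {y : E₁ × E₂} (hΦ : DifferentiableAt ℝ Φ y)
    (x : E₁) : fderiv ℝ Φ y (x, 0) = fderiv ℝ (fun t ↦ Φ (t, y.2)) y.1 x := by
  have h := HasFDerivAt.comp y.1 hΦ.hasFDerivAt (hasFDerivAt_prodMk_left (𝕜 := ℝ) y.1 y.2)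
  exact (DFunLike.congr_fun h.fderiv x).symm

theorem fderiv_apply_inr {Φ : E₁ × E₂ → W} {y : E₁ × E₂} (hΦ : DifferentiableAt ℝ Φ y)
    (x : E₂) : fderiv ℝ Φ y (0, x) = fderiv ℝ (fun s ↦ Φ (y.1, s)) y.2 x := by
  have h := HasFDerivAt.comp y.2 hΦ.hasFDerivAt (hasFDerivAt_prodMk_right (𝕜 := ℝ) y.1 y.2)
  exact (DFunLike.congr_fun h.fderiv x).symm

theorem fst_fderiv_inl {Φ : E₁ × E₂ → W × E₂} {y : E₁ × E₂} (hΦ : DifferentiableAt ℝ Φ y)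
    {ψ : E₁ → W} (hψ : ∀ᶠ z in 𝓝 y, z.2 = y.2 → (Φ z).1 = ψ z.1) (x : E₁) :
    (fderiv ℝ Φ y (x, 0)).1 = fderiv ℝ ψ y.1 x := by
  have h : (fun t ↦ (Φ (t, y.2)).1) =ᶠ[𝓝 y.1] ψ :=
    ((Continuous.prodMk_left y.2).continuousAt.eventually hψ).mono fun t ht ↦ ht rfl
  rw [← h.fderiv_eq, ← fderiv_apply_inl (Φ := fun z ↦ (Φ z).1) hΦ.fst]
  rw [fderiv.fst hΦ]; rfl

theorem fst_fderiv_inr {Φ : E₁ × E₂ → W × E₂} {y : E₁ × E₂} (hΦ : DifferentiableAt ℝ Φ y)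
    {ψ : E₂ → W} (hψ : ∀ᶠ z in 𝓝 y, z.1 = y.1 → (Φ z).1 = ψ z.2) (x : E₂) :
    (fderiv ℝ Φ y (0, x)).1 = fderiv ℝ ψ y.2 x := by
  have h : (fun s ↦ (Φ (y.1, s)).1) =ᶠ[𝓝 y.2] ψ :=
    ((Continuous.prodMk_right y.1).continuousAt.eventually hψ).mono fun t ht ↦ ht rfl
  rw [← h.fderiv_eq, ← fderiv_apply_inr (Φ := fun z ↦ (Φ z).1) hΦ.fst]
  rw [fderiv.fst hΦ]; rfl

theorem snd_fderiv_inr {Φ : E₁ × E₂ → E₁ × W} {y : E₁ × E₂} (hΦ : DifferentiableAt ℝ Φ y)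
    {ψ : E₂ → W} (hψ : ∀ᶠ z in 𝓝 y, z.1 = y.1 → (Φ z).2 = ψ z.2) (x : E₂) :
    (fderiv ℝ Φ y (0, x)).2 = fderiv ℝ ψ y.2 x := by
  have h : (fun s ↦ (Φ (y.1, s)).2) =ᶠ[𝓝 y.2] ψ :=
    ((Continuous.prodMk_right y.1).continuousAt.eventually hψ).mono fun t ht ↦ ht rfl
  rw [← h.fderiv_eq, ← fderiv_apply_inr (Φ := fun z ↦ (Φ z).2) hΦ.snd]
  rw [fderiv.snd hΦ]; rfl

/-- Differentiability of `η` is not needed: at a point where `η` is not differentiable, neither is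
`η ∘ Prod.fst`, and both sides are zero. -/
theorem fderiv_comp_fst (η : E₁ → W) (y : E₁ × E₂) :
    fderiv ℝ (fun z : E₁ × E₂ ↦ η z.1) y =
      (fderiv ℝ η y.1).comp (ContinuousLinearMap.fst ℝ E₁ E₂) := by
  by_cases hη : DifferentiableAt ℝ η y.1
  · exact (hη.hasFDerivAt.comp y hasFDerivAt_fst).fderiv
  · have hη' : ¬ DifferentiableAt ℝ (fun z : E₁ × E₂ ↦ η z.1) y := fun h ↦
      hη (DifferentiableAt.comp (g := fun z : E₁ × E₂ ↦ η z.1) (f := fun t ↦ (t, y.2)) y.1 h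
        (differentiableAt_id.prodMk (differentiableAt_const _)))
    rw [fderiv_zero_of_not_differentiableAt hη, fderiv_zero_of_not_differentiableAt hη',
      ContinuousLinearMap.zero_comp]

/-- The trace of an endomorphism of a product is the sum of the traces of its diagonal blocks. -/
theorem trace_prod_eq [FiniteDimensional ℝ E₁] [FiniteDimensional ℝ E₂]
    (T : E₁ × E₂ →ₗ[ℝ] E₁ × E₂) :
    LinearMap.trace ℝ (E₁ × E₂) T =
      LinearMap.trace ℝ E₁ (LinearMap.fst ℝ E₁ E₂ ∘ₗ T ∘ₗ LinearMap.inl ℝ E₁ E₂) +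
      LinearMap.trace ℝ E₂ (LinearMap.snd ℝ E₁ E₂ ∘ₗ T ∘ₗ LinearMap.inr ℝ E₁ E₂) := by
  rw [LinearMap.trace_comp_comm' (T ∘ₗ LinearMap.inl ℝ E₁ E₂),
    LinearMap.trace_comp_comm' (T ∘ₗ LinearMap.inr ℝ E₁ E₂), ← map_add]
  congr 1
  refine LinearMap.ext fun z ↦ ?_
  simp [← map_add]

end Product

/-! ### Curvature of a warped product in coordinates -/

section WarpedCoordinates

variable {E₁ E₂ : Type*} [NormedAddCommGroup E₁] [NormedSpace ℝ E₁] [NormedAddCommGroup E₂]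
  [NormedSpace ℝ E₂]

/-- The metric `b + φ² k` on a product of coordinate spaces. -/
noncomputable def warpedCoord (b : E₁ → E₁ →L[ℝ] E₁ →L[ℝ] ℝ) (φ : E₁ → ℝ)
    (k : E₂ → E₂ →L[ℝ] E₂ →L[ℝ] ℝ) (z : E₁ × E₂) : E₁ × E₂ →L[ℝ] E₁ × E₂ →L[ℝ] ℝ :=
  pullbackForm (b z.1) (ContinuousLinearMap.fst ℝ E₁ E₂) +
    φ z.1 ^ 2 • pullbackForm (k z.2) (ContinuousLinearMap.snd ℝ E₁ E₂)

variable {b : E₁ → E₁ →L[ℝ] E₁ →L[ℝ] ℝ} {φ : E₁ → ℝ} {k : E₂ → E₂ →L[ℝ] E₂ →L[ℝ] ℝ}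
  {y : E₁ × E₂}

theorem warpedCoord_apply (u v : E₁ × E₂) :
    warpedCoord b φ k y u v = b y.1 u.1 v.1 + φ y.1 ^ 2 * k y.2 u.2 v.2 := rfl

theorem contDiffAt_warpedCoord (hb : ContDiffAt ℝ ∞ b y.1) (hφ : ContDiffAt ℝ ∞ φ y.1)
    (hk : ContDiffAt ℝ ∞ k y.2) : ContDiffAt ℝ ∞ (warpedCoord b φ k) y := by
  have h₁ : ContDiffAt ℝ ∞ (fun z : E₁ × E₂ ↦
      pullbackForm (b z.1) (ContinuousLinearMap.fst ℝ E₁ E₂)) y :=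
    (contDiff_pullbackForm _).contDiffAt.comp y (hb.comp y contDiffAt_fst)
  have h₂ : ContDiffAt ℝ ∞ (fun z : E₁ × E₂ ↦
      pullbackForm (k z.2) (ContinuousLinearMap.snd ℝ E₁ E₂)) y :=
    (contDiff_pullbackForm _).contDiffAt.comp y (hk.comp y contDiffAt_snd)
  have h₃ : ContDiffAt ℝ ∞ (fun z : E₁ × E₂ ↦ φ z.1 ^ 2) y := (hφ.comp y contDiffAt_fst).pow 2
  exact h₁.add (contDiffAt_smul h₃ h₂)

theorem isInvertible_warpedCoord [FiniteDimensional ℝ E₁] [FiniteDimensional ℝ E₂]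
    (hb : (b y.1).IsInvertible) (hφ : φ y.1 ≠ 0) (hk : (k y.2).IsInvertible) :
    (warpedCoord b φ k y).IsInvertible := by
  refine isInvertible_of_nondegenerate _ fun u hu ↦ Prod.ext ?_ ?_
  · refine hb.injective (ContinuousLinearMap.ext fun v ↦ ?_)
    simpa [warpedCoord_apply] using hu (v, 0)
  · refine hk.injective (ContinuousLinearMap.ext fun v ↦ ?_)
    simpa [warpedCoord_apply, hφ] using hu (0, v)

set_option maxSynthPendingDepth 5 in
theorem fderiv_warpedCoord_apply (hb : DifferentiableAt ℝ b y.1) (hφ : DifferentiableAt ℝ φ y.1)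
    (hk : DifferentiableAt ℝ k y.2) (u v w : E₁ × E₂) :
    fderiv ℝ (warpedCoord b φ k) y u v w =
      fderiv ℝ b y.1 u.1 v.1 w.1 + φ y.1 ^ 2 * fderiv ℝ k y.2 u.2 v.2 w.2 +
        2 * φ y.1 * fderiv ℝ φ y.1 u.1 * k y.2 v.2 w.2 := by
  have hP₁ := (contDiff_pullbackForm (ContinuousLinearMap.fst ℝ E₁ E₂)).differentiable (by simp)
  have hP₂ := (contDiff_pullbackForm (ContinuousLinearMap.snd ℝ E₁ E₂)).differentiable (by simp)
  have hb' := hb.hasFDerivAt.comp y (hasFDerivAt_fst (𝕜 := ℝ) (p := y))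
  have hk' := hk.hasFDerivAt.comp y (hasFDerivAt_snd (𝕜 := ℝ) (p := y))
  have hφ' := hφ.hasFDerivAt.comp y (hasFDerivAt_fst (𝕜 := ℝ) (p := y))
  have hG : DifferentiableAt ℝ (warpedCoord b φ k) y :=
    ((hP₁ _).comp y hb'.differentiableAt).add
      ((hφ'.differentiableAt.pow 2).smul ((hP₂ _).comp y hk'.differentiableAt))
  have h₁ := (hG.hasFDerivAt.clm_apply (hasFDerivAt_const v y)).clm_apply (hasFDerivAt_const w y)
  have h₂ := (((hb'.clm_apply (hasFDerivAt_const v.1 y)).clm_apply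
    (hasFDerivAt_const w.1 y))).add ((hφ'.pow 2).mul
      ((hk'.clm_apply (hasFDerivAt_const v.2 y)).clm_apply (hasFDerivAt_const w.2 y)))
  have h := DFunLike.congr_fun (h₁.unique h₂) u
  simp at h
  rw [h]
  ring

/-- The Christoffel symbols of `b + φ² k`. -/
theorem christoffel_warpedCoord [FiniteDimensional ℝ E₁] [FiniteDimensional ℝ E₂]
    (hb : DifferentiableAt ℝ b y.1) (hφ : DifferentiableAt ℝ φ y.1)
    (hk : DifferentiableAt ℝ k y.2) (hb' : (b y.1).IsInvertible) (hφ' : φ y.1 ≠ 0)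
    (hk' : (k y.2).IsInvertible) (u v : E₁ × E₂) :
    christoffel (warpedCoord b φ k) y u v =
      (christoffel b y.1 u.1 v.1 - (φ y.1 * k y.2 u.2 v.2) • gradient b φ y.1,
        christoffel k y.2 u.2 v.2 + (fderiv ℝ φ y.1 u.1 / φ y.1) • v.2 +
          (fderiv ℝ φ y.1 v.1 / φ y.1) • u.2) := by
  refine christoffel_eq_of_koszul (isInvertible_warpedCoord hb' hφ' hk') fun w ↦ ?_
  simp only [warpedCoord_apply, map_sub, map_add, map_smul, sub_apply, add_apply, smul_apply,
    smul_eq_mul, form_christoffel hb', form_christoffel hk', form_gradient hb', koszul_apply,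
    fderiv_warpedCoord_apply hb hφ hk]
  field_simp
  ring

/-- The first diagonal block of `u ↦ R(u, v) w`, for `v` and `w` tangent to the second factor of
`b + φ² k`, is this endomorphism of the first factor times `k v w`. In invariant terms, it is
`u ↦ -φ ∇_u ∇φ`. -/
noncomputable def warpedBaseBlock (b : E₁ → E₁ →L[ℝ] E₁ →L[ℝ] ℝ) (φ : E₁ → ℝ) (x : E₁) :
    E₁ →ₗ[ℝ] E₁ where
  toFun u := fderiv ℝ φ x u • gradient b φ x - fderiv ℝ (fun t ↦ φ t • gradient b φ t) x u -
    φ x • christoffel b x u (gradient b φ x)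
  map_add' u u' := by
    simp only [christoffel_add_left, map_add]
    module
  map_smul' c u := by
    simp only [christoffel_smul_left, map_smul, RingHom.id_apply, smul_eq_mul]
    module

/-- The part of the Ricci tensor of `b + φ² k` on vectors tangent to the second factor that does
not come from `k` is this number times `k`, where `n` is the dimension of the second factor, see
`localRicci_warpedCoord`. In invariant terms, it is `-(φ Δφ + (n - 1) |∇φ|²)`. -/
noncomputable def warpedRicciCoeff (b : E₁ → E₁ →L[ℝ] E₁ →L[ℝ] ℝ) (φ : E₁ → ℝ) (n : ℕ)
    (x : E₁) : ℝ :=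
  LinearMap.trace ℝ E₁ (warpedBaseBlock b φ x) + (1 - n) * fderiv ℝ φ x (gradient b φ x)

/-- The Ricci tensor of `b + φ² k` on vectors tangent to the second factor: the two diagonal blocks
of `u ↦ R(u, v) w` are read off from the Christoffel symbols. -/
theorem localRicci_warpedCoord [FiniteDimensional ℝ E₁] [FiniteDimensional ℝ E₂]
    (hb : ContDiffAt ℝ ∞ b y.1) (hφ : ContDiffAt ℝ ∞ φ y.1)
    (hk : ContDiffAt ℝ ∞ k y.2) (hb' : (b y.1).IsInvertible) (hφ' : φ y.1 ≠ 0)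
    (hk' : (k y.2).IsInvertible) (v w : E₂) :
    localRicci (warpedCoord b φ k) y (0, v) (0, w) =
      localRicci k y.2 v w +
        warpedRicciCoeff b φ (Module.finrank ℝ E₂) y.1 * k y.2 v w := by
  have hG := contDiffAt_warpedCoord hb hφ hk
  have hG' := isInvertible_warpedCoord hb' hφ' hk'
  have hΓd := differentiableAt_christoffel hG hG'
  have hΓ : ∀ᶠ z in 𝓝 y, ∀ u v : E₁ × E₂, christoffel (warpedCoord b φ k) z u v =
      (christoffel b z.1 u.1 v.1 - (φ z.1 * k z.2 u.2 v.2) • gradient b φ z.1,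
        christoffel k z.2 u.2 v.2 + (fderiv ℝ φ z.1 u.1 / φ z.1) • v.2 +
          (fderiv ℝ φ z.1 v.1 / φ z.1) • u.2) := by
    have e₁ := ((hb.of_le (m := 1) (by simp)).eventually (by simp)).and
      ((eventually_isInvertible hb.continuousAt hb').and
        (((hφ.of_le (m := 1) (by simp)).eventually (by simp)).and (hφ.continuousAt.eventually_ne hφ')))
    have e₂ := ((hk.of_le (m := 1) (by simp)).eventually (by simp)).and (eventually_isInvertible hk.continuousAt hk')
    filter_upwards [continuousAt_fst.eventually e₁, continuousAt_snd.eventually e₂] with z h₁ h₂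
    exact christoffel_warpedCoord (h₁.1.differentiableAt (by simp))
      (h₁.2.2.1.differentiableAt (by simp)) (h₂.1.differentiableAt (by simp)) h₁.2.1 h₁.2.2.2 h₂.2
  have hΓy := hΓ.self_of_nhds
  obtain ⟨T, hT⟩ := exists_linearMap_curvature hG hG' (0, v) (0, w)
  obtain ⟨S, hS⟩ := exists_linearMap_curvature hk hk' v w
  have h₁ (x : E₁) : (curvature (warpedCoord b φ k) y (x, 0) (0, v) (0, w)).1 =
      k y.2 v w • warpedBaseBlock b φ y.1 x := by
    -- The first component of `D_x Γ(v, w)`, and that of `D_v Γ(x, w)`, which vanishes.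
    have a₁ := fst_fderiv_inl (hΓd (0, v) (0, w))
      (ψ := fun t ↦ (-k y.2 v w) • (φ t • gradient b φ t)) (hΓ.mono fun z hz hzy ↦ by
        rw [hz, hzy]
        simp [smul_smul, mul_comm]) x
    have a₂ := fst_fderiv_inr (hΓd (x, 0) (0, w)) (ψ := fun _ ↦ 0) (hΓ.mono fun z hz hzy ↦ by
        rw [hz]
        simp) v
    rw [fderiv_fun_const_smul ((hφ.differentiableAt (by simp)).fun_smul
      (differentiableAt_gradient hb hb' hφ))] at a₁
    simp only [curvature, Prod.fst_add, Prod.fst_sub, a₁, a₂]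
    simp only [hΓy]
    simp only [christoffel_zero_left, christoffel_zero_right, map_zero, zero_apply, mul_zero,
      zero_smul, zero_div, zero_sub, sub_zero, zero_add, add_zero, smul_zero, map_smul, smul_apply,
      smul_eq_mul, ← neg_smul,
      christoffel_smul_right, fderiv_fun_const]
    simp only [Pi.zero_apply, zero_apply, warpedBaseBlock, LinearMap.coe_mk, AddHom.coe_mk]
    match_scalars <;> field_simp
  have h₂ (u : E₂) : (curvature (warpedCoord b φ k) y (0, u) (0, v) (0, w)).2 =
      S u + fderiv ℝ φ y.1 (gradient b φ y.1) • (k y.2 u w • v - k y.2 v w • u) := by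
    -- Along the second factor, the second component of `Γ(p, w)` is that of the metric `k`.
    have a (p q : E₂) := snd_fderiv_inr (hΓd (0, p) (0, w))
      (ψ := fun s ↦ christoffel k s p w) (hΓ.mono fun z hz hzy ↦ by
        rw [hz]
        simp) q
    rw [hS]
    simp only [curvature, Prod.snd_add, Prod.snd_sub, a]
    simp only [hΓy]
    simp only [christoffel_zero_right, map_zero, zero_smul, zero_div, zero_sub, add_zero, map_neg, map_smul, smul_eq_mul]
    match_scalars <;> field_simp
  rw [localRicci_eq_trace T hT, localRicci_eq_trace S hS, trace_prod_eq, warpedRicciCoeff,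
    show LinearMap.fst ℝ E₁ E₂ ∘ₗ T ∘ₗ LinearMap.inl ℝ E₁ E₂ =
        k y.2 v w • warpedBaseBlock b φ y.1 from
      LinearMap.ext fun x ↦ (congrArg Prod.fst (hT (x, 0))).trans (h₁ x),
    show LinearMap.snd ℝ E₁ E₂ ∘ₗ T ∘ₗ LinearMap.inr ℝ E₁ E₂ =
        S + fderiv ℝ φ y.1 (gradient b φ y.1) •
          (((k y.2).flip w).toLinearMap.smulRight v - k y.2 v w • LinearMap.id) from
      LinearMap.ext fun u ↦ (congrArg Prod.snd (hT (0, u))).trans (h₂ u)]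
  simp only [map_add, map_smul, map_sub, LinearMap.trace_smulRight, LinearMap.trace_id,
    smul_eq_mul]
  change _ + (_ + _ * (k y.2 v w - _)) = _
  ring

/-- The Hessian, for `b + φ² k`, of a function of the first variable, on vectors tangent to the
second factor. -/
theorem localHessian_warpedCoord [FiniteDimensional ℝ E₁] [FiniteDimensional ℝ E₂]
    (hb : DifferentiableAt ℝ b y.1) (hφ : DifferentiableAt ℝ φ y.1)
    (hk : DifferentiableAt ℝ k y.2) (hb' : (b y.1).IsInvertible) (hφ' : φ y.1 ≠ 0)
    (hk' : (k y.2).IsInvertible) (η : E₁ → ℝ) (v w : E₂) :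
    localHessian (warpedCoord b φ k) (fun z ↦ η z.1) y (0, v) (0, w) =
      φ y.1 * fderiv ℝ η y.1 (gradient b φ y.1) * k y.2 v w := by
  rw [localHessian, christoffel_warpedCoord hb hφ hk hb' hφ' hk']
  simp only [fderiv_comp_fst, ContinuousLinearMap.comp_apply, ContinuousLinearMap.coe_fst']
  simp
  ring

end WarpedCoordinates

/-! ### Passage to manifolds -/

section Charts

variable {E : Type*} [NormedAddCommGroup E] [NormedSpace ℝ E]
  {H : Type*} [TopologicalSpace H] {I : ModelWithCorners ℝ E H}
  {M : Type*} [TopologicalSpace M] [ChartedSpace H M] [IsManifold I ∞ M]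

theorem Metric.ricci_eq [FiniteDimensional ℝ E] (g : Metric I M) (x : M) (u v : E) :
    g.ricci x u v = localRicci (inChart I g.form x) (extChartAt I x x) u v := by
  have : IsManifold I 1 M := .of_le (n := ∞) (by simp)
  have h := mfderiv_extChartAt_self (I := I) (x := x)
  exact congrArg₂ (localRicci _ _) (DFunLike.congr_fun h u) (DFunLike.congr_fun h v)

theorem Metric.hessian_eq (g : Metric I M) (h : M → ℝ) (x : M) (u v : E) :
    g.hessian h x u v =
      localHessian (inChart I g.form x) (h ∘ (extChartAt I x).symm) (extChartAt I x x) u v := by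
  have : IsManifold I 1 M := .of_le (n := ∞) (by simp)
  have hd := mfderiv_extChartAt_self (I := I) (x := x)
  exact congrArg₂ (localHessian _ _ _) (DFunLike.congr_fun hd u) (DFunLike.congr_fun hd v)

variable [I.Boundaryless]

omit [IsManifold I ∞ M] in
theorem contDiffAt_comp_extChartAt_symm {f : M → ℝ} (hf : ContMDiff I 𝓘(ℝ, ℝ) ∞ f) (x : M) :
    ContDiffAt ℝ ∞ (f ∘ (extChartAt I x).symm) (extChartAt I x x) := by
  have h := (contMDiffAt_iff.1 (hf x)).2
  rwa [ModelWithCorners.range_eq_univ, contDiffWithinAt_univ] at h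

theorem inChart_self_apply (g : ∀ x : M, TangentSpace I x →L[ℝ] TangentSpace I x →L[ℝ] ℝ) (x : M)
    (u v : E) : inChart I g x (extChartAt I x x) u v = g x u v := by
  have : IsManifold I 1 M := .of_le (n := ∞) (by simp)
  have h := mfderivWithin_range_extChartAt_symm (I := I) (x := x)
  rw [ModelWithCorners.range_eq_univ, mfderivWithin_univ] at h
  rw [inChart, h]
  have hz : ∀ z, z = x → (g z : E →L[ℝ] E →L[ℝ] ℝ) u v = (g x : E →L[ℝ] E →L[ℝ] ℝ) u v := by
    rintro _ rfl
    rfl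
  exact hz _ (extChartAt_to_inv x)

theorem Metric.contDiffAt_inChart (g : Metric I M) (x : M) :
    ContDiffAt ℝ ∞ (inChart I g.form x) (extChartAt I x x) :=
  (contMDiffAt_iff_inChart I g.form x).1 (g.contMDiff x)

theorem Metric.isInvertible_inChart [FiniteDimensional ℝ E] (g : Metric I M) (x : M) :
    (inChart I g.form x (extChartAt I x x)).IsInvertible :=
  isInvertible_of_nondegenerate _ fun u hu ↦ g.nondegenerate x u fun v ↦
    (inChart_self_apply g.form x u v).symm.trans (hu v)

end Charts

section WarpedProduct

variable {EB : Type*} [NormedAddCommGroup EB] [NormedSpace ℝ EB]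
  {HB : Type*} [TopologicalSpace HB] {IB : ModelWithCorners ℝ EB HB}
  {B : Type*} [TopologicalSpace B] [ChartedSpace HB B]
  {EF : Type*} [NormedAddCommGroup EF] [NormedSpace ℝ EF]
  {HF : Type*} [TopologicalSpace HF] {IF : ModelWithCorners ℝ EF HF}
  {F : Type*} [TopologicalSpace F] [ChartedSpace HF F]

theorem extChartAt_prod_self (p : B × F) : extChartAt (IB.prod IF) p p =
    (extChartAt IB p.1 p.1, extChartAt IF p.2 p.2) := by
  rw [extChartAt_prod]
  rfl

variable [IB.Boundaryless] [IF.Boundaryless] [IsManifold IB ∞ B] [IsManifold IF ∞ F]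

theorem inChart_warpedForm_eventuallyEq (gB : Metric IB B) (gF : Metric IF F) (f : B → ℝ)
    (p : B × F) :
    inChart (IB.prod IF) (warpedForm gB.form f gF.form) p
      =ᶠ[𝓝 (extChartAt IB p.1 p.1, extChartAt IF p.2 p.2)]
      warpedCoord (inChart IB gB.form p.1) (f ∘ (extChartAt IB p.1).symm)
        (inChart IF gF.form p.2) := by
  rw [← extChartAt_prod_self]
  exact Filter.eventually_of_mem (extChartAt_target_mem_nhds (I := IB.prod IF) p)
    fun y hy ↦ inChart_warpedForm gB.form f gF.form p hy

variable [FiniteDimensional ℝ EB] [FiniteDimensional ℝ EF]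

/-- On vertical vectors, the Ricci tensor of `B ×_f F` at `(p, q)` is that of the fiber plus a
multiple of the metric of the fiber by a number that depends on `p` only. -/
theorem ricci_warpedProduct_vertical (gB : Metric IB B) (gF : Metric IF F) {f : B → ℝ}
    (hf : ContMDiff IB 𝓘(ℝ, ℝ) ∞ f) (hpos : ∀ x, 0 < f x) (p : B) (q : F) (u v : EF) :
    (warpedProduct gB gF f hf hpos).ricci (p, q) ((0 : EB), u) ((0 : EB), v) =
      gF.ricci q u v + warpedRicciCoeff (inChart IB gB.form p) (f ∘ (extChartAt IB p).symm)
        (Module.finrank ℝ EF) (extChartAt IB p p) * gF.form q u v := by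
  refine (Metric.ricci_eq _ _ _ _).trans ?_
  rw [extChartAt_prod_self, Metric.ricci_eq, ← inChart_self_apply gF.form]
  change localRicci (inChart (IB.prod IF) (warpedForm gB.form f gF.form) (p, q)) _ _ _ = _
  rw [localRicci_congr (inChart_warpedForm_eventuallyEq gB gF f (p, q))]
  exact localRicci_warpedCoord (y := (extChartAt IB p p, extChartAt IF q q))
    (gB.contDiffAt_inChart p) (contDiffAt_comp_extChartAt_symm hf p)
    (gF.contDiffAt_inChart q) (gB.isInvertible_inChart p) (hpos _).ne' (gF.isInvertible_inChart q)
    u v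

/-- On vertical vectors, the Hessian on `B ×_f F` at `(p, q)` of the lift of a function on `B` is a
multiple of the metric of the fiber by a number that depends on `p` only. -/
theorem hessian_warpedProduct_vertical (gB : Metric IB B) (gF : Metric IF F) {f : B → ℝ}
    (hf : ContMDiff IB 𝓘(ℝ, ℝ) ∞ f) (hpos : ∀ x, 0 < f x) (h : B → ℝ) (p : B) (q : F) (u v : EF) :
    (warpedProduct gB gF f hf hpos).hessian (fun z ↦ h z.1) (p, q) ((0 : EB), u) ((0 : EB), v) =
      f p * fderiv ℝ (h ∘ (extChartAt IB p).symm) (extChartAt IB p p)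
        (gradient (inChart IB gB.form p) (f ∘ (extChartAt IB p).symm) (extChartAt IB p p)) *
          gF.form q u v := by
  have hη : (fun z : B × F ↦ h z.1) ∘ (extChartAt (IB.prod IF) (p, q)).symm =
      fun z ↦ (h ∘ (extChartAt IB p).symm) z.1 := by
    rw [extChartAt_prod]
    rfl
  have hp : (f ∘ (extChartAt IB p).symm) (extChartAt IB p p) = f p :=
    congrArg f (extChartAt_to_inv p)
  refine (Metric.hessian_eq _ _ _ _ _).trans ?_
  rw [extChartAt_prod_self, hη, ← inChart_self_apply gF.form, ← hp]
  change localHessian (inChart (IB.prod IF) (warpedForm gB.form f gF.form) (p, q)) _ _ _ _ = _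
  rw [localHessian_congr (inChart_warpedForm_eventuallyEq gB gF f (p, q))]
  exact localHessian_warpedCoord (y := (extChartAt IB p p, extChartAt IF q q))
    ((gB.contDiffAt_inChart p).differentiableAt (by simp))
    ((contDiffAt_comp_extChartAt_symm hf p).differentiableAt (by simp))
    ((gF.contDiffAt_inChart q).differentiableAt (by simp)) (gB.isInvertible_inChart p)
    (hpos _).ne' (gF.isInvertible_inChart q) _ u v

end WarpedProduct

end SemiRiem

/-- If the warped product `B ×_f F` of two semi-Riemannian manifolds is a gradient Ricci soliton
whose potential function is (the lift of) a function `h` on the base, and `f` is non-constant, then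
the fiber is an Einstein manifold. -/
theorem corollary1p1
    {EB : Type*} [NormedAddCommGroup EB] [NormedSpace ℝ EB] [FiniteDimensional ℝ EB]
    {HB : Type*} [TopologicalSpace HB] {IB : ModelWithCorners ℝ EB HB} [IB.Boundaryless]
    {B : Type*} [TopologicalSpace B] [ChartedSpace HB B] [IsManifold IB ∞ B]
    {EF : Type*} [NormedAddCommGroup EF] [NormedSpace ℝ EF] [FiniteDimensional ℝ EF]
    {HF : Type*} [TopologicalSpace HF] {IF : ModelWithCorners ℝ EF HF} [IF.Boundaryless]
    {F : Type*} [TopologicalSpace F] [ChartedSpace HF F] [IsManifold IF ∞ F]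
    (gB : SemiRiem.Metric IB B) (gF : SemiRiem.Metric IF F)
    (f : B → ℝ) (hf : ContMDiff IB 𝓘(ℝ, ℝ) ∞ f) (hpos : ∀ x, 0 < f x)
    (hnonconst : ∃ x y : B, f x ≠ f y)
    (h : B → ℝ)
    (hsoliton : (SemiRiem.warpedProduct gB gF f hf hpos).IsGradientRicciSoliton
      (fun p : B × F ↦ h p.1)) :
    gF.IsEinstein := by
  -- The Einstein constant is computed over the fixed point `p` of the base.
  obtain ⟨p, -, -⟩ := hnonconst
  obtain ⟨-, ρ, hρ⟩ := hsoliton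
  refine ⟨ρ * f p ^ 2 - SemiRiem.warpedRicciCoeff (SemiRiem.inChart IB gB.form p)
      (f ∘ (extChartAt IB p).symm) (Module.finrank ℝ EF) (extChartAt IB p p) -
    f p * fderiv ℝ (h ∘ (extChartAt IB p).symm) (extChartAt IB p p)
      (SemiRiem.gradient (SemiRiem.inChart IB gB.form p) (f ∘ (extChartAt IB p).symm)
        (extChartAt IB p p)), fun q u v ↦ ?_⟩
  have hform : (SemiRiem.warpedProduct gB gF f hf hpos).form (p, q) ((0 : EB), u) ((0 : EB), v) =
      f p ^ 2 * gF.form q u v := by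
    refine (SemiRiem.warpedForm_apply gB.form f gF.form (p, q) _ _).trans ?_
    have h0 : gB.form p (0 : TangentSpace IB p) (0 : TangentSpace IB p) = 0 := map_zero _
    exact (congrArg (· + f p ^ 2 * gF.form q u v) h0).trans (zero_add _)
  have hs := (congrArg₂ (· + ·) (SemiRiem.ricci_warpedProduct_vertical gB gF hf hpos p q u v)
    (SemiRiem.hessian_warpedProduct_vertical gB gF hf hpos h p q u v)).symm.trans
      ((hρ (p, q) ((0 : EB), u) ((0 : EB), v)).trans (congrArg (ρ * ·) hform))
  linear_combination hs
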